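/- Let $\mathcal H$ and $\mathcal G$ be real Hilbert spaces. **Notation.** Set-valued operators $A\colon\mathcal H\to 2^{\mathcal H}$ are added, subtracted and scaled pointwise in the sense of Minkowski, functions are identified with single-valued operators, and $A^{-1}$ is the operator defined by $x\in A^{-1}u\Leftrightarrow u\in Ax$. We write $\operatorname{zer}A=\{x: 0\in Ax\}$ and $\operatorname{Fix}A=\{x: x\in Ax\}$. The resolvent of $A$ is $J_A=(A+\mathrm{Id})^{-1}$, and its Yosida approximation of index $\gamma>0$ is ${}^{\gamma}\!A=\gamma^{-1}(\mathrm{Id}-J_{\gamma A})$. The operator $A$ is maximally monotone if, for all $x,u\in\mathcal H$, one has $u\in Ax$ if and only if $\langle x-y, u-v\rangle\ge 0$ for all $y\in\mathcal H$ and all $v\in Ay$. For a bounded linear operator $L\colon\mathcal H\to\mathcal G$ and $B\colon\mathcal G\to 2^{\mathcal G}$, set $$L\diamond B=\big(L^*\circ(B+\mathrm{Id}_{\mathcal G})^{-1}\circ L\big)^{-1}-\mathrm{Id}_{\mathcal H}\quad\text{(resolvent composition)},$$ $$L\mathbin{\bullet}B=\big(L\diamond B^{-1}\big)^{-1}\quad\text{(resolvent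 cocomposition)}.$$ For a closed vector subspace $V$, $\operatorname{proj}_V$ is the orthogonal projection onto $V$, and $N_V$ is the normal cone operator: $N_Vx=\{u:\langle y-x, u\rangle\le 0 \text{ for all } y\in V\}$ if $x\in V$, and $N_Vx=\varnothing$ otherwise. **Theorem 6.3.** Let $L\colon\mathcal H\to\mathcal G$ be a bounded linear operator with $0<\|L\|\le 1$, let $B\colon\mathcal G\to 2^{\mathcal G}$ be maximally monotone, let $V\ne\{0\}$ be a closed vector subspace of $\mathcal H$, and let $\gamma\in\left]0,+\infty\right[$. Set $$A=L\mathbin{\bullet}(\gamma B),\qquad M=\operatorname{proj}_V\diamond A,$$ $$S_1=\{x\in V: 0\in B(Lx)\},\qquad S_2=\operatorname{zer}M.$$ Then the following hold: 1. $M$ is maximally monotone. 2. $J_{\gamma B}$ is single-valued and defined on all of $\mathcal G$, and $$J_M=\operatorname{proj}_V\circ\big(\mathrm{Id}_{\mathcal H}-L^*\circ L+L^*\circ J_{\gamma B}\circ L\big)\circ\operatorname{proj}_V.$$ 3. $S_1$ and $S_2$ are closed convex sets. 4. $S_2=\operatorname{Fix}\big(\operatorname{proj}_V\circ(\mathrm{Id}_{\mathcal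 H}-L^*\circ L+L^*\circ J_{\gamma B}\circ L)\big)$. 5. The relaxation is exact: if $S_1\neq\varnothing$, then $S_2=S_1$. 6. $S_2=\operatorname{zer}\big(N_V+L^*\circ({}^{\gamma}\!B)\circ L\big)$. -/

import Mathlib

open scoped Pointwise

/-! Set-valued operators from `X` to `Y` are functions `X → Set Y`. Sums, differences and real
multiples of them are taken pointwise in the sense of Minkowski:
`(A + B) x = {u + v | u ∈ A x, v ∈ B x}` and `(γ • A) x = {γ • u | u ∈ A x}`. -/

namespace SetValued

section General

variable {X Y Z : Type*}

/-- A function, regarded as a set-valued operator. -/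
def ofFun (f : X → Y) : X → Set Y := fun x => {f x}

/-- The inverse of a set-valued operator: `x ∈ A⁻¹ y ↔ y ∈ A x`. -/
def inverse (A : X → Set Y) : Y → Set X := fun y => {x | y ∈ A x}

/-- The composition `B ∘ A` of set-valued operators. -/
def comp (B : Y → Set Z) (A : X → Set Y) : X → Set Z := fun x => {z | ∃ y ∈ A x, z ∈ B y}

/-- The fixed points of a set-valued operator. -/
def fixedPoints (A : X → Set X) : Set X := {x | x ∈ A x}

/-- The zeros of a set-valued operator. -/
def zeros [Zero Y] (A : X → Set Y) : Set X := {x | 0 ∈ A x}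

/-- The identity `Id` as a set-valued operator. -/
def ident (X : Type*) : X → Set X := ofFun id

/-- The resolvent `J_A = (A + Id)⁻¹`. -/
def resolvent [Add X] (A : X → Set X) : X → Set X := inverse (A + ident X)

/-- The Yosida approximation `γ⁻¹ (Id - J_{γ A})` of `A` of index `γ`. -/
noncomputable def yosida [AddCommGroup X] [Module ℝ X] (γ : ℝ) (A : X → Set X) : X → Set X :=
  γ⁻¹ • (ident X - resolvent (γ • A))

end General

section Hilbert

variable {H G : Type*}
  [NormedAddCommGroup H] [InnerProductSpace ℝ H]
  [NormedAddCommGroup G] [InnerProductSpace ℝ G]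

/-- Maximal monotonicity: `(x, u)` is in the graph of `A` if and only if it is monotonically
related to every point of the graph of `A`. -/
def MaximallyMonotone (A : H → Set H) : Prop :=
  ∀ x u : H, u ∈ A x ↔ ∀ y v : H, v ∈ A y → 0 ≤ inner ℝ (x - y) (u - v)

/-- The normal cone operator of a set `C`: it is empty outside `C`. -/
def normalCone (C : Set H) : H → Set H :=
  fun x => {u | x ∈ C ∧ ∀ y ∈ C, inner ℝ (y - x) u ≤ 0}

variable [CompleteSpace H] [CompleteSpace G]

/-- The composition `L* ∘ B ∘ L`. -/
noncomputable def conj (L : H →L[ℝ] G) (B : G → Set G) : H → Set H :=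
  comp (ofFun (ContinuousLinearMap.adjoint L)) (comp B (ofFun L))

/-- The parallel composition of `B` with `L*`, that is, `(L* ∘ B⁻¹ ∘ L)⁻¹`. -/
noncomputable def parallelComp (L : H →L[ℝ] G) (B : G → Set G) : H → Set H :=
  inverse (conj L (inverse B))

/-- The resolvent composition of `B` with `L`: the parallel composition of `B + Id` with `L*`,
minus `Id`. -/
noncomputable def resolventComp (L : H →L[ℝ] G) (B : G → Set G) : H → Set H :=
  parallelComp L (B + ident G) - ident H

/-- The resolvent cocomposition of `B` with `L`: the inverse of the resolvent composition
of `B⁻¹` with `L`. -/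
noncomputable def resolventCocomp (L : H →L[ℝ] G) (B : G → Set G) : H → Set H :=
  inverse (resolventComp L (inverse B))

/-- The orthogonal projection onto a closed vector subspace, as a bounded operator on `H`. -/
noncomputable def proj (V : ClosedSubmodule ℝ H) : H →L[ℝ] H := V.toSubmodule.starProjection

/-- The operator `Id - L* ∘ L + L* ∘ J_{γ B} ∘ L`. -/
noncomputable def innerResolvent (L : H →L[ℝ] G) (γ : ℝ) (B : G → Set G) : H → Set H :=
  ofFun (fun x => x - ContinuousLinearMap.adjoint L (L x)) + conj L (resolvent (γ • B))

/-- The relaxed operator: the resolvent composition with `proj V` of the resolvent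
cocomposition of `γ B` with `L`. -/
noncomputable def relaxedOperator (L : H →L[ℝ] G) (B : G → Set G) (V : ClosedSubmodule ℝ H)
    (γ : ℝ) : H → Set H :=
  resolventComp (proj V) (resolventCocomp L (γ • B))

/-- The solutions of the original problem: the `x ∈ V` with `0 ∈ B (L x)`. -/
def originalSolutions (L : H →L[ℝ] G) (B : G → Set G) (V : ClosedSubmodule ℝ H) : Set H :=
  {x | x ∈ V ∧ 0 ∈ B (L x)}

/-- The solutions of the relaxed problem: the zeros of the relaxed operator. -/
def relaxedSolutions (L : H →L[ℝ] G) (B : G → Set G) (V : ClosedSubmodule ℝ H) (γ : ℝ) : Set H :=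
  zeros (relaxedOperator L B V γ)

end Hilbert

end SetValued

/-! Operators are handled through their resolvents: `HasResolvent A T` says that the everywhere
defined map `T` determines the graph of `A`. In these terms inversion is `T ↦ Id - T` and resolvent
composition is `T ↦ L* T L`. With `T` the resolvent of `γ B`, the cocomposition has resolvent `Id -
L* (Id - T) L`, and `M` has its compression by `proj V`. Both moves preserve firm nonexpansiveness
when `‖L‖ ≤ 1`, and a firmly nonexpansive resolvent forces maximal monotonicity. The existence of
`T` is Minty's theorem, obtained by minimising the Fitzpatrick function plus half the squared norm.
The zeros of `M` are the `x ∈ V` with `L* (L x - T (L x))` orthogonal to `V`; the fixed-point and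
normal-cone descriptions restate this, and exactness uses firm nonexpansiveness of `Id - T`. -/

namespace SetValued

/-! ### Minimising a convex function plus half the squared norm -/

section Minimisation

variable {E : Type*} [NormedAddCommGroup E] [InnerProductSpace ℝ E] [CompleteSpace E]

/-- On a nonempty closed convex subset of `E × ℝ`, the function `(z, t) ↦ t + ‖z‖² / 2` attains
its infimum if it is bounded below. -/
theorem exists_forall_add_half_sq_norm_le {K : Set (E × ℝ)} (hne : K.Nonempty)
    (hcl : IsClosed K) (hco : Convex ℝ K) (hbd : ∀ p ∈ K, 0 ≤ p.2 + ‖p.1‖ ^ 2 / 2) :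
    ∃ p ∈ K, ∀ q ∈ K, p.2 + ‖p.1‖ ^ 2 / 2 ≤ q.2 + ‖q.1‖ ^ 2 / 2 := by
  set f : E × ℝ → ℝ := fun p => p.2 + ‖p.1‖ ^ 2 / 2 with hf
  have hbelow : BddBelow (f '' K) := ⟨0, by rintro _ ⟨p, hp, rfl⟩; exact hbd p hp⟩
  set m := sInf (f '' K) with hm
  have hle : ∀ p ∈ K, m ≤ f p := fun p hp => csInf_le hbelow ⟨p, hp, rfl⟩
  have hex : ∀ n : ℕ, ∃ p ∈ K, f p < m + 1 / ((n : ℝ) + 1) := by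
    intro n
    obtain ⟨_, ⟨p, hp, rfl⟩, h⟩ := exists_lt_of_csInf_lt (hne.image f)
      (show sInf (f '' K) < m + 1 / ((n : ℝ) + 1) by
        have : 0 < 1 / ((n : ℝ) + 1) := by positivity
        linarith)
    exact ⟨p, hp, h⟩
  choose p hpK hpm using hex
  -- Strong convexity: the midpoint lies in `K`, so the parallelogram law makes near-minimisers
  -- close.
  have hmid : ∀ a ∈ K, ∀ b ∈ K, ∀ ε, f a ≤ m + ε → f b ≤ m + ε →
      ‖a.1 - b.1‖ ^ 2 ≤ 8 * ε := by
    intro a ha b hb ε hae hbe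
    have h := hle _ (hco ha hb (a := 1 / 2) (b := 1 / 2) (by norm_num) (by norm_num) (by norm_num))
    have hpar := parallelogram_law_with_norm ℝ a.1 b.1
    have hn : ‖(1 / 2 : ℝ) • a.1 + (1 / 2 : ℝ) • b.1‖ = ‖a.1 + b.1‖ / 2 := by
      rw [← smul_add, norm_smul]; norm_num; ring
    simp only [hf, Prod.fst_add, Prod.snd_add, Prod.smul_fst, Prod.smul_snd, smul_eq_mul, hn]
      at h hae hbe
    nlinarith
  have htend : Filter.Tendsto (fun n : ℕ => 1 / ((n : ℝ) + 1)) Filter.atTop (nhds 0) :=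
    tendsto_one_div_add_atTop_nhds_zero_nat
  have hcauchy : CauchySeq fun n => (p n).1 := by
    refine cauchySeq_of_le_tendsto_0 (fun n : ℕ => Real.sqrt (8 * (1 / ((n : ℝ) + 1)))) ?_ ?_
    · intro a b N ha hb
      rw [dist_eq_norm]
      have hmono : ∀ k : ℕ, N ≤ k → f (p k) ≤ m + 1 / ((N : ℝ) + 1) := fun k hk =>
        (hpm k).le.trans (by gcongr)
      exact Real.le_sqrt_of_sq_le
        (hmid _ (hpK a) _ (hpK b) _ (hmono a ha) (hmono b hb))
    · have := (htend.const_mul 8).sqrt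
      simpa using this
  obtain ⟨z, hz⟩ := cauchySeq_tendsto_of_complete hcauchy
  have hfm : Filter.Tendsto (fun n => f (p n)) Filter.atTop (nhds m) := by
    refine tendsto_of_tendsto_of_tendsto_of_le_of_le tendsto_const_nhds ?_
      (fun n => hle _ (hpK n)) (fun n => (hpm n).le)
    simpa using htend.const_add m
  have hsnd : Filter.Tendsto (fun n => (p n).2) Filter.atTop (nhds (m - ‖z‖ ^ 2 / 2)) := by
    refine (hfm.sub ((hz.norm.pow 2).div_const 2)).congr fun n => ?_
    simp [hf]
  refine ⟨(z, m - ‖z‖ ^ 2 / 2), hcl.mem_of_tendsto (hz.prodMk_nhds hsnd)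
    (Filter.Eventually.of_forall hpK), fun q hq => ?_⟩
  simpa using hle q hq

/-- The variational inequality satisfied by the minimiser of `(z, t) ↦ t + ‖z‖² / 2` over a
convex set. -/
theorem inner_le_of_forall_add_half_sq_norm_le {E : Type*} [NormedAddCommGroup E]
    [InnerProductSpace ℝ E] {K : Set (E × ℝ)} (hco : Convex ℝ K) {p q : E × ℝ} (hp : p ∈ K)
    (hmin : ∀ q ∈ K, p.2 + ‖p.1‖ ^ 2 / 2 ≤ q.2 + ‖q.1‖ ^ 2 / 2) (hq : q ∈ K) :
    p.2 + inner ℝ p.1 (p.1 - q.1) ≤ q.2 := by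
  by_contra! hlt
  set c := p.2 + inner ℝ p.1 (p.1 - q.1) - q.2 with hc
  have hc0 : 0 < c := by linarith
  set D := ‖p.1 - q.1‖ ^ 2 with hD
  have hD0 : 0 ≤ D := by positivity
  -- Moving from `p` a fraction `s` towards `q` changes the objective by `-s * c + s ^ 2 * D / 2`;
  -- this `s` makes it negative.
  set s := c / (c + D) with hs
  have hs0 : 0 < s := by positivity
  have hs1 : s ≤ 1 := by rw [hs, div_le_one (by positivity)]; linarith
  have h := hmin _ (hco hp hq (a := 1 - s) (b := s) (by linarith) hs0.le (by ring))
  have hn : ‖(1 - s) • p.1 + s • q.1‖ ^ 2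
      = ‖p.1‖ ^ 2 - 2 * s * inner ℝ p.1 (p.1 - q.1) + s ^ 2 * D := by
    have : (1 - s) • p.1 + s • q.1 = p.1 - s • (p.1 - q.1) := by module
    rw [this, norm_sub_sq_real, inner_smul_right, norm_smul, mul_pow, Real.norm_eq_abs, sq_abs]
    ring
  simp only [Prod.fst_add, Prod.snd_add, Prod.smul_fst, Prod.smul_snd, smul_eq_mul, hn] at h
  have hsD : s * D < 2 * c := by
    have : s * (c + D) = c := by rw [hs]; field_simp
    nlinarith
  have : 0 ≤ s * (s * D - 2 * c) := by rw [hc]; nlinarith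
  nlinarith

end Minimisation

/-! ### Fitzpatrick function and Minty's theorem -/

section Minty

variable {H : Type*} [NormedAddCommGroup H] [InnerProductSpace ℝ H]

theorem MaximallyMonotone.nonempty_graph {A : H → Set H} (hA : MaximallyMonotone A) :
    ∃ y v, v ∈ A y := by
  by_contra! h
  exact h 0 0 ((hA 0 0).2 fun y v hv => absurd hv (h y v))

/-- The epigraph of the Fitzpatrick function of `A`. -/
def fitzpatrickEpigraph (A : H → Set H) : Set (WithLp 2 (H × H) × ℝ) :=
  {p | ∀ y v, v ∈ A y → inner ℝ p.1.fst v + inner ℝ y p.1.snd - inner ℝ y v ≤ p.2}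

theorem isClosed_fitzpatrickEpigraph (A : H → Set H) : IsClosed (fitzpatrickEpigraph A) := by
  simp only [fitzpatrickEpigraph, Set.ofPred_forall]
  refine isClosed_iInter fun y => isClosed_iInter fun v => isClosed_iInter fun _ =>
    isClosed_le ?_ continuous_snd
  have h1 : Continuous fun p : WithLp 2 (H × H) × ℝ => p.1.fst :=
    (continuous_fst.comp (WithLp.prod_continuous_ofLp 2 H H)).comp continuous_fst
  have h2 : Continuous fun p : WithLp 2 (H × H) × ℝ => p.1.snd :=
    (continuous_snd.comp (WithLp.prod_continuous_ofLp 2 H H)).comp continuous_fst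
  fun_prop

theorem convex_fitzpatrickEpigraph (A : H → Set H) : Convex ℝ (fitzpatrickEpigraph A) := by
  intro p hp q hq a b ha hb hab y v hv
  have h1 := mul_le_mul_of_nonneg_left (hp y v hv) ha
  have h2 := mul_le_mul_of_nonneg_left (hq y v hv) hb
  simp only [Prod.fst_add, Prod.snd_add, Prod.smul_fst, Prod.smul_snd, smul_eq_mul,
    WithLp.add_fst, WithLp.add_snd, WithLp.smul_fst, WithLp.smul_snd, inner_add_left,
    inner_add_right, real_inner_smul_left, real_inner_smul_right]
  have : b = 1 - a := by linarith
  subst this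
  nlinarith

/-- A point violating the bound would be monotonically related to the whole graph, hence lie in it;
testing the epigraph inequality at that very point is a contradiction. -/
theorem MaximallyMonotone.inner_le_of_mem_fitzpatrickEpigraph {A : H → Set H}
    (hA : MaximallyMonotone A) {p : WithLp 2 (H × H) × ℝ} (hp : p ∈ fitzpatrickEpigraph A) :
    inner ℝ p.1.fst p.1.snd ≤ p.2 := by
  by_contra! hlt
  have hmem : p.1.snd ∈ A p.1.fst := (hA _ _).2 fun y v hv => by
    have := hp y v hv
    simp only [inner_sub_left, inner_sub_right]
    linarith
  have := hp _ _ hmem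
  linarith

theorem MaximallyMonotone.mem_fitzpatrickEpigraph {A : H → Set H} (hA : MaximallyMonotone A)
    {x u : H} (h : u ∈ A x) :
    ((WithLp.toLp 2 (x, u), inner ℝ x u) : WithLp 2 (H × H) × ℝ) ∈ fitzpatrickEpigraph A := by
  intro y v hv
  have := (hA x u).1 h y v hv
  simp only [inner_sub_left, inner_sub_right] at this
  show inner ℝ x v + inner ℝ y u - inner ℝ y v ≤ inner ℝ x u
  linarith

theorem MaximallyMonotone.exists_neg_mem [CompleteSpace H] {A : H → Set H}
    (hA : MaximallyMonotone A) : ∃ x, -x ∈ A x := by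
  obtain ⟨y₀, v₀, h₀⟩ := hA.nonempty_graph
  have hco := convex_fitzpatrickEpigraph A
  obtain ⟨⟨z, t⟩, hp, hmin⟩ := exists_forall_add_half_sq_norm_le
    ⟨_, hA.mem_fitzpatrickEpigraph h₀⟩ (isClosed_fitzpatrickEpigraph A) hco (by
      intro p hp
      have h1 := hA.inner_le_of_mem_fitzpatrickEpigraph hp
      have h2 := norm_add_sq_real p.1.fst p.1.snd
      rw [WithLp.prod_norm_sq_eq_of_L2]
      nlinarith [sq_nonneg ‖p.1.fst + p.1.snd‖])
  set x := z.fst with hx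
  set u := z.snd with hu
  have hxu : inner ℝ x u ≤ t := hA.inner_le_of_mem_fitzpatrickEpigraph hp
  have hsq := norm_add_sq_real x u
  have key : ∀ y v, v ∈ A y → ‖x + u‖ ^ 2 ≤ inner ℝ (-u - y) (-x - v) := by
    intro y v hv
    have h := inner_le_of_forall_add_half_sq_norm_le hco hp hmin (hA.mem_fitzpatrickEpigraph hv)
    simp only [WithLp.prod_inner_apply, inner_sub_right] at h
    change t + (inner ℝ x x + inner ℝ u u - (inner ℝ x y + inner ℝ u v)) ≤ inner ℝ y v at h
    simp only [inner_sub_left, inner_sub_right, inner_neg_left, inner_neg_right]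
    rw [real_inner_self_eq_norm_sq, real_inner_self_eq_norm_sq] at h
    rw [real_inner_comm u x] at *
    rw [real_inner_comm x y] at *
    linarith
  have hmem : -x ∈ A (-u) := (hA _ _).2 fun y v hv => (sq_nonneg _).trans (key y v hv)
  -- At the graph point just found, the right-hand side of `key` vanishes.
  have h0 := key _ _ hmem
  rw [sub_self, inner_zero_left] at h0
  have : x + u = 0 := by simpa using le_antisymm h0 (sq_nonneg _)
  refine ⟨x, ?_⟩
  rwa [neg_eq_of_add_eq_zero_left this] at hmem

/-- **Minty's theorem**: if `A` is maximally monotone, then `A + Id` is surjective. -/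
theorem MaximallyMonotone.exists_sub_mem [CompleteSpace H] {A : H → Set H}
    (hA : MaximallyMonotone A) (w : H) : ∃ x, w - x ∈ A x := by
  -- Translating the values by `w` reduces to the case `w = 0`.
  have hA' : MaximallyMonotone fun x => {u | u + w ∈ A x} := by
    intro x u
    refine (hA x (u + w)).trans ⟨fun h y v hv => ?_, fun h y v hv => ?_⟩
    · simpa using h y (v + w) hv
    · have := h y (v - w) (by simpa using hv)
      rwa [← sub_add, sub_add_eq_add_sub] at this
  obtain ⟨x, hx⟩ := hA'.exists_neg_mem
  exact ⟨x, by simpa [neg_add_eq_sub] using hx⟩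

/-- By maximality the zeros form an intersection of closed half-spaces, one for each graph point. -/
theorem MaximallyMonotone.isClosed_convex_zeros {A : H → Set H} (hA : MaximallyMonotone A) :
    IsClosed (zeros A) ∧ Convex ℝ (zeros A) := by
  have h : zeros A = ⋂ (y) (v) (_ : v ∈ A y), {x | 0 ≤ inner ℝ (x - y) (0 - v)} := by
    ext x
    simpa [zeros] using hA x 0
  rw [h]
  refine ⟨isClosed_iInter fun y => isClosed_iInter fun v => isClosed_iInter fun _ =>
    isClosed_le continuous_const (by fun_prop),
    convex_iInter fun y => convex_iInter fun v => convex_iInter fun _ => ?_⟩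
  intro p hp q hq a b ha hb hab
  have h1 := mul_nonneg ha hp
  have h2 := mul_nonneg hb hq
  have h3 : a • p + b • q - y = a • (p - y) + b • (q - y) := by
    obtain rfl := eq_sub_of_add_eq hab
    module
  rw [Set.mem_ofPred_eq, h3, inner_add_left, real_inner_smul_left, real_inner_smul_left]
  exact add_nonneg h1 h2

theorem MaximallyMonotone.smul {A : H → Set H} (hA : MaximallyMonotone A) {γ : ℝ} (hγ : 0 < γ) :
    MaximallyMonotone (γ • A) := by
  have hmem : ∀ x u, u ∈ (γ • A) x ↔ γ⁻¹ • u ∈ A x := fun x u =>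
    Set.mem_smul_set_iff_inv_smul_mem₀ hγ.ne' (A x) u
  intro x u
  rw [hmem, hA]
  refine ⟨fun h y v hv => ?_, fun h y v hv => ?_⟩
  · have := mul_nonneg hγ.le (h y _ ((hmem y v).1 hv))
    rwa [← real_inner_smul_right, smul_sub, smul_inv_smul₀ hγ.ne', smul_inv_smul₀ hγ.ne'] at this
  · have := mul_nonneg (inv_nonneg.2 hγ.le)
      (h y (γ • v) ((hmem _ _).2 (by rwa [inv_smul_smul₀ hγ.ne'])))
    rwa [← real_inner_smul_right, smul_sub, inv_smul_smul₀ hγ.ne'] at this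

end Minty

/-! ### Calculus of resolvents -/

section ResolventMaps

variable {X : Type*} [AddCommGroup X]

/-- The map `T` is the resolvent of the set-valued operator `A`. -/
def HasResolvent (A : X → Set X) (T : X → X) : Prop :=
  ∀ x u, u ∈ A x ↔ T (x + u) = x

theorem HasResolvent.mem_add_ident {A : X → Set X} {T : X → X} (h : HasResolvent A T) (x w : X) :
    w ∈ (A + ident X) x ↔ T w = x := by
  rw [show (A + ident X) x = A x + {x} from rfl, Set.add_singleton, Set.mem_image]
  constructor
  · rintro ⟨u, hu, rfl⟩
    rw [add_comm]
    exact (h x u).1 hu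
  · intro hw
    exact ⟨w - x, (h x _).2 (by rwa [add_sub_cancel]), sub_add_cancel w x⟩

theorem HasResolvent.resolvent_eq {A : X → Set X} {T : X → X} (h : HasResolvent A T) :
    resolvent A = ofFun T := by
  ext w x
  exact (h.mem_add_ident x w).trans eq_comm

theorem HasResolvent.mem_zeros {A : X → Set X} {T : X → X} (h : HasResolvent A T) (x : X) :
    x ∈ zeros A ↔ T x = x := by
  simpa [zeros] using h x 0

theorem HasResolvent.inverse {A : X → Set X} {T : X → X} (h : HasResolvent A T) :
    HasResolvent (inverse A) fun x => x - T x := by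
  intro x u
  refine (h u x).trans ?_
  rw [add_comm u x, sub_eq_iff_eq_add, add_right_inj, eq_comm]

theorem HasResolvent.zero_mem_iff {X : Type*} [AddCommGroup X] [Module ℝ X] {B : X → Set X}
    {T : X → X} {γ : ℝ} (hγ : γ ≠ 0) (h : HasResolvent (γ • B) T) (y : X) :
    0 ∈ B y ↔ T y = y := by
  rw [← h.mem_zeros, zeros, Set.mem_ofPred_eq, Pi.smul_apply, Set.mem_smul_set_iff_inv_smul_mem₀ hγ,
    smul_zero]

end ResolventMaps

/-! ### Firm nonexpansiveness and resolvent compositions -/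

section Resolvents

variable {H G : Type*}
  [NormedAddCommGroup H] [InnerProductSpace ℝ H]
  [NormedAddCommGroup G] [InnerProductSpace ℝ G]

/-- Firm nonexpansiveness of a map. -/
def FirmlyNonexpansive (T : H → H) : Prop :=
  ∀ x y, ‖T x - T y‖ ^ 2 ≤ inner ℝ (x - y) (T x - T y)

theorem FirmlyNonexpansive.id_sub {T : H → H} (hT : FirmlyNonexpansive T) :
    FirmlyNonexpansive fun x => x - T x := by
  intro x y
  have h := hT x y
  have h1 : x - T x - (y - T y) = x - y - (T x - T y) := by abel
  simp only [h1]
  rw [norm_sub_sq_real, inner_sub_right (x - y) (x - y), real_inner_self_eq_norm_sq]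
  linarith

theorem HasResolvent.maximallyMonotone {A : H → Set H} {T : H → H} (h : HasResolvent A T)
    (hT : FirmlyNonexpansive T) : MaximallyMonotone A := by
  intro x u
  rw [h]
  refine ⟨fun hx y v hv => ?_, fun hx => ?_⟩
  · rw [h] at hv
    have := hT (x + u) (y + v)
    rw [hx, hv, add_sub_add_comm, inner_add_left, real_inner_self_eq_norm_sq,
      real_inner_comm] at this
    linarith
  -- Test against the graph point whose coordinates also sum to `x + u`: the inner product is then
  -- `-‖x - T (x + u)‖ ^ 2`.
  · have := hx (T (x + u)) (x + u - T (x + u)) ((h _ _).2 (by rw [add_sub_cancel]))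
    rw [show u - (x + u - T (x + u)) = -(x - T (x + u)) by abel, inner_neg_right,
      real_inner_self_eq_norm_sq] at this
    have h0 : ‖x - T (x + u)‖ ^ 2 = 0 := le_antisymm (by linarith) (sq_nonneg _)
    rw [sq_eq_zero_iff, norm_eq_zero, sub_eq_zero] at h0
    exact h0.symm

theorem MaximallyMonotone.exists_hasResolvent [CompleteSpace H] {A : H → Set H}
    (hA : MaximallyMonotone A) : ∃ T, HasResolvent A T ∧ FirmlyNonexpansive T := by
  choose T hT using hA.exists_sub_mem
  have hfirm : ∀ x u y v, u ∈ A x → v ∈ A y →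
      ‖x - y‖ ^ 2 ≤ inner ℝ (x + u - (y + v)) (x - y) := by
    intro x u y v hu hv
    have := (hA x u).1 hu y v hv
    rw [add_sub_add_comm, inner_add_left, real_inner_self_eq_norm_sq, real_inner_comm]
    linarith
  refine ⟨T, fun x u => ⟨fun hu => ?_, fun hx => ?_⟩, fun x y => ?_⟩
  · have := hfirm _ _ _ _ (hT (x + u)) hu
    rw [add_sub_cancel, sub_self, inner_zero_left] at this
    have h0 := le_antisymm this (sq_nonneg _)
    rwa [sq_eq_zero_iff, norm_eq_zero, sub_eq_zero] at h0
  · simpa [hx] using hT (x + u)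
  · simpa using hfirm _ _ _ _ (hT x) (hT y)

variable [CompleteSpace H] [CompleteSpace G]

theorem conj_ofFun (L : H →L[ℝ] G) (T : G → G) :
    conj L (ofFun T) = ofFun fun x => ContinuousLinearMap.adjoint L (T (L x)) := by
  ext x u
  simp [conj, comp, ofFun]

theorem HasResolvent.resolventComp {A : G → Set G} {T : G → G} (h : HasResolvent A T)
    (L : H →L[ℝ] G) :
    HasResolvent (resolventComp L A) fun x => ContinuousLinearMap.adjoint L (T (L x)) := by
  intro x u
  have h1 : SetValued.inverse (A + ident G) = ofFun T := h.resolvent_eq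
  rw [SetValued.resolventComp, parallelComp, h1, conj_ofFun,
    show ∀ C : H → Set H, (C - ident H) x = C x - {x} from fun _ => rfl, Set.sub_singleton,
    Set.mem_image]
  constructor
  · rintro ⟨w, hw, rfl⟩
    rw [add_sub_cancel]
    exact hw.symm
  · intro hx
    exact ⟨x + u, hx.symm, add_sub_cancel_left x u⟩

theorem FirmlyNonexpansive.conj {T : G → G} (hT : FirmlyNonexpansive T) {L : H →L[ℝ] G}
    (hL : ‖L‖ ≤ 1) : FirmlyNonexpansive fun x => ContinuousLinearMap.adjoint L (T (L x)) := by
  intro x y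
  simp only [← map_sub]
  rw [ContinuousLinearMap.adjoint_inner_right, map_sub L]
  refine le_trans ?_ (hT (L x) (L y))
  gcongr
  refine (ContinuousLinearMap.le_opNorm _ _).trans (mul_le_of_le_one_left (norm_nonneg _) ?_)
  rwa [LinearIsometryEquiv.norm_map]

theorem HasResolvent.resolventCocomp {A : G → Set G} {T : G → G} (h : HasResolvent A T)
    (L : H →L[ℝ] G) :
    HasResolvent (resolventCocomp L A) fun x =>
      x - ContinuousLinearMap.adjoint L (L x - T (L x)) :=
  (h.inverse.resolventComp L).inverse

end Resolvents

theorem neg_mem_normalCone_iff {H : Type*} [NormedAddCommGroup H] [InnerProductSpace ℝ H]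
    (V : ClosedSubmodule ℝ H) {x d : H} :
    -d ∈ normalCone (V : Set H) x ↔ x ∈ V ∧ ∀ y ∈ V, inner ℝ y d = 0 := by
  refine and_congr_right fun hx => ⟨fun h y hy => ?_, fun h y hy => ?_⟩
  · have h1 := h (x + y) (V.toSubmodule.add_mem hx hy)
    have h2 := h (x - y) (V.toSubmodule.sub_mem hx hy)
    simp only [add_sub_cancel_left, sub_sub_cancel_left, inner_neg_left, inner_neg_right] at h1 h2
    linarith
  · rw [inner_neg_right, h _ (V.toSubmodule.sub_mem hy hx), neg_zero]

/-! ### Projection onto a closed subspace -/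

section Projection

variable {H : Type*} [NormedAddCommGroup H] [InnerProductSpace ℝ H] [CompleteSpace H]
  (V : ClosedSubmodule ℝ H)

theorem adjoint_proj : ContinuousLinearMap.adjoint (proj V) = proj V :=
  (isSelfAdjoint_starProjection V.toSubmodule).adjoint_eq

theorem proj_eq_self_iff {x : H} : proj V x = x ↔ x ∈ V :=
  Submodule.starProjection_eq_self_iff

theorem proj_mem (x : H) : proj V x ∈ V :=
  Submodule.starProjection_apply_mem V.toSubmodule x

theorem proj_eq_zero_iff {x : H} : proj V x = 0 ↔ ∀ y ∈ V, inner ℝ y x = 0 :=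
  (Submodule.starProjection_apply_eq_zero_iff _).trans (Submodule.mem_orthogonal _ _)

theorem norm_proj_le : ‖proj V‖ ≤ 1 :=
  Submodule.starProjection_norm_le V.toSubmodule

theorem proj_sub_eq_self_iff {x d : H} :
    proj V (x - d) = x ↔ x ∈ V ∧ ∀ y ∈ V, inner ℝ y d = 0 := by
  rw [← proj_eq_zero_iff]
  constructor
  · intro h
    have hx : x ∈ V := h ▸ proj_mem V _
    rw [map_sub, (proj_eq_self_iff V).2 hx, sub_eq_self] at h
    exact ⟨hx, h⟩
  · rintro ⟨hx, hd⟩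
    rw [map_sub, (proj_eq_self_iff V).2 hx, hd, sub_zero]

end Projection

/-! ### The relaxed problem -/

section Relaxation

variable {H G : Type*}
  [NormedAddCommGroup H] [InnerProductSpace ℝ H] [CompleteSpace H]
  [NormedAddCommGroup G] [InnerProductSpace ℝ G] [CompleteSpace G]
  {L : H →L[ℝ] G} {B : G → Set G} {V : ClosedSubmodule ℝ H} {γ : ℝ} {T : G → G}

theorem HasResolvent.innerResolvent_eq (h : HasResolvent (γ • B) T) :
    innerResolvent L γ B = ofFun fun x => x - ContinuousLinearMap.adjoint L (L x - T (L x)) := by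
  funext x
  rw [innerResolvent, h.resolvent_eq, conj_ofFun]
  simp only [Pi.add_apply, ofFun, Set.singleton_add_singleton, map_sub]
  congr 1
  abel

theorem HasResolvent.conj_yosida_eq (h : HasResolvent (γ • B) T) :
    conj L (yosida γ B) =
      ofFun fun x => γ⁻¹ • ContinuousLinearMap.adjoint L (L x - T (L x)) := by
  have h1 : yosida γ B = ofFun fun y => γ⁻¹ • (y - T y) := by
    funext y
    rw [yosida, h.resolvent_eq]
    simp [ofFun, ident]
  rw [h1, conj_ofFun]
  simp only [map_smul]

theorem HasResolvent.relaxedOperator (h : HasResolvent (γ • B) T) :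
    HasResolvent (relaxedOperator L B V γ) fun x =>
      proj V (proj V x - ContinuousLinearMap.adjoint L (L (proj V x) - T (L (proj V x)))) := by
  have := (h.resolventCocomp L).resolventComp (proj V)
  rwa [adjoint_proj] at this

theorem HasResolvent.mem_relaxedSolutions_iff (h : HasResolvent (γ • B) T) {x : H} :
    x ∈ relaxedSolutions L B V γ ↔
      x ∈ V ∧ ∀ y ∈ V, inner ℝ y (ContinuousLinearMap.adjoint L (L x - T (L x))) = 0 := by
  rw [relaxedSolutions, h.relaxedOperator.mem_zeros, ← proj_sub_eq_self_iff]
  -- Either equation puts `x` in the range of `proj V`, so the inner projections can be dropped.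
  have key : proj V x = x →
      (proj V (proj V x - ContinuousLinearMap.adjoint L (L (proj V x) - T (L (proj V x)))) = x ↔
        proj V (x - ContinuousLinearMap.adjoint L (L x - T (L x))) = x) := fun hx => by rw [hx]
  exact ⟨fun hx => (key ((proj_eq_self_iff V).2 (hx ▸ proj_mem V _))).1 hx,
    fun hx => (key ((proj_eq_self_iff V).2 (hx ▸ proj_mem V _))).2 hx⟩

theorem HasResolvent.relaxedSolutions_eq (hγ : γ ≠ 0) (h : HasResolvent (γ • B) T)
    (hT : FirmlyNonexpansive T) (hne : (originalSolutions L B V).Nonempty) :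
    relaxedSolutions L B V γ = originalSolutions L B V := by
  obtain ⟨z, hzV, hz⟩ := hne
  rw [h.zero_mem_iff hγ] at hz
  ext x
  rw [h.mem_relaxedSolutions_iff]
  refine and_congr_right fun hx => ?_
  rw [h.zero_mem_iff hγ]
  constructor
  · intro hd
    -- As `Id - T` vanishes at `L z`, this bounds `‖L x - T (L x)‖ ^ 2` by a pairing of `x - z ∈ V`
    -- with a vector orthogonal to `V`.
    have h1 := hT.id_sub (L x) (L z)
    simp only [hz, sub_self, sub_zero] at h1
    rw [← map_sub, ← ContinuousLinearMap.adjoint_inner_right,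
      hd _ (V.toSubmodule.sub_mem hx hzV)] at h1
    have h0 := le_antisymm h1 (sq_nonneg _)
    rw [sq_eq_zero_iff, norm_eq_zero, sub_eq_zero] at h0
    exact h0.symm
  · intro hd y _
    rw [hd, sub_self, map_zero, inner_zero_right]

theorem HasResolvent.relaxedSolutions_eq_zeros (hγ : γ ≠ 0) (h : HasResolvent (γ • B) T) :
    relaxedSolutions L B V γ = zeros (normalCone (V : Set H) + conj L (yosida γ B)) := by
  ext x
  rw [h.mem_relaxedSolutions_iff, h.conj_yosida_eq, zeros, Set.mem_ofPred_eq, Pi.add_apply, ofFun,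
    Set.add_singleton, Set.mem_image]
  have h1 : ∀ d : H, (∃ u ∈ normalCone (V : Set H) x, u + γ⁻¹ • d = 0) ↔
      -(γ⁻¹ • d) ∈ normalCone (V : Set H) x := fun d =>
    ⟨fun ⟨u, hu, h0⟩ => by rwa [← eq_neg_of_add_eq_zero_left h0],
      fun hd => ⟨_, hd, neg_add_cancel _⟩⟩
  rw [h1, neg_mem_normalCone_iff]
  simp [real_inner_smul_right, hγ]

end Relaxation

end SetValued

theorem theorem6p3
    {H G : Type*}
    [NormedAddCommGroup H] [InnerProductSpace ℝ H] [CompleteSpace H]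
    [NormedAddCommGroup G] [InnerProductSpace ℝ G] [CompleteSpace G]
    (L : H →L[ℝ] G) (hL_pos : 0 < ‖L‖) (hL_le : ‖L‖ ≤ 1)
    (B : G → Set G) (hB : SetValued.MaximallyMonotone B)
    (V : ClosedSubmodule ℝ H) (hV : V ≠ ⊥)
    (γ : ℝ) (hγ : 0 < γ) :
    -- the relaxed operator is maximally monotone
    SetValued.MaximallyMonotone (SetValued.relaxedOperator L B V γ) ∧
    -- the resolvent of `γ B` is single-valued and defined everywhere, and the resolvent of the
    -- relaxed operator is `proj_V ∘ (Id - L* ∘ L + L* ∘ J_{γ B} ∘ L) ∘ proj_V`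
    (∀ y : G, ∃! p : G, p ∈ SetValued.resolvent (γ • B) y) ∧
    SetValued.resolvent (SetValued.relaxedOperator L B V γ) =
      SetValued.comp (SetValued.ofFun (SetValued.proj V))
        (SetValued.comp (SetValued.innerResolvent L γ B)
          (SetValued.ofFun (SetValued.proj V))) ∧
    -- both solution sets are closed and convex
    (IsClosed (SetValued.originalSolutions L B V) ∧
      Convex ℝ (SetValued.originalSolutions L B V)) ∧
    (IsClosed (SetValued.relaxedSolutions L B V γ) ∧
      Convex ℝ (SetValued.relaxedSolutions L B V γ)) ∧
    -- the relaxed solutions are the fixed points of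
    -- `proj_V ∘ (Id - L* ∘ L + L* ∘ J_{γ B} ∘ L)`
    SetValued.relaxedSolutions L B V γ =
      SetValued.fixedPoints
        (SetValued.comp (SetValued.ofFun (SetValued.proj V))
          (SetValued.innerResolvent L γ B)) ∧
    -- the relaxation is exact
    ((SetValued.originalSolutions L B V).Nonempty →
      SetValued.relaxedSolutions L B V γ = SetValued.originalSolutions L B V) ∧
    -- the relaxed solutions are the zeros of the sum of the normal cone operator of `V` and
    -- `L* ∘ (Yosida approximation of B of index γ) ∘ L`
    SetValued.relaxedSolutions L B V γ =
      SetValued.zeros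
        (SetValued.normalCone (V : Set H) +
          SetValued.conj L (SetValued.yosida γ B)) := by
  have hB' := hB.smul hγ
  obtain ⟨T, hT, hfirm⟩ := hB'.exists_hasResolvent
  have hM : SetValued.MaximallyMonotone (SetValued.relaxedOperator L B V γ) := by
    refine hT.relaxedOperator.maximallyMonotone ?_
    have h := ((hfirm.id_sub.conj hL_le).id_sub).conj (SetValued.norm_proj_le V)
    rwa [SetValued.adjoint_proj] at h
  obtain ⟨hBcl, hBco⟩ := hB.isClosed_convex_zeros
  refine ⟨hM, fun y => ?_, ?_, ⟨?_, ?_⟩, hM.isClosed_convex_zeros, ?_,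
    hT.relaxedSolutions_eq hγ.ne' hfirm, hT.relaxedSolutions_eq_zeros hγ.ne'⟩
  · rw [hT.resolvent_eq]
    exact existsUnique_eq
  · rw [hT.relaxedOperator.resolvent_eq, hT.innerResolvent_eq]
    ext x u
    simp [SetValued.comp, SetValued.ofFun]
  · exact V.isClosed.inter (hBcl.preimage L.continuous)
  · exact V.toSubmodule.convex.inter (hBco.linear_preimage L.toLinearMap)
  · ext x
    rw [hT.innerResolvent_eq, hT.mem_relaxedSolutions_iff, ← SetValued.proj_sub_eq_self_iff]
    simp [SetValued.comp, SetValued.ofFun, SetValued.fixedPoints, eq_comm]
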